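/- Let $n\geq 3$ be an integer and let $G$ be a finite group of order $2^n$ that is not elementary abelian. Then $$|L(G)|\leq |L(D_8\times C_2^{n-3})|,$$ where $L(H)$ denotes the set of all subgroups of a group $H$, $D_8$ is the dihedral group of order $8$, and $C_2^{n-3}$ is the direct product of $n-3$ copies of the cyclic group $C_2$ of order $2$ (the trivial group if $n=3$). -/

import Mathlib

/-- A group is an elementary abelian `p`-group if it is abelian and every element `x`
satisfies `x ^ p = 1`. -/
def IsElementaryAbelianGroup (p : ℕ) (G : Type*) [Group G] : Prop :=
  (∀ x y : G, x * y = y * x) ∧ ∀ x : G, x ^ p = 1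

/-- The group `C_2 ^ m`: the direct product of `m` copies of the cyclic group of order 2,
written multiplicatively. -/
abbrev C2Pow (m : ℕ) : Type := Fin m → Multiplicative (ZMod 2)

/-! Write s_k for the number of subgroups of C₂^k and put m = n - 3. The common bound is 3s_{m+2} -
3s_{m+1} + s_m.

Let z be a central involution of a 2-group G. Subgroups containing z are the subgroups of G/⟨z⟩.
Those avoiding z are complements of ⟨z⟩ in preimages of subgroups K of G/⟨z⟩; once one complement
over K is chosen, the others correspond to characters K → C₂, so they embed in the subgroups of
G/⟨z⟩ × C₂ that avoid the factor C₂. Hence passing to G/⟨z⟩ × C₂ loses no subgroups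
(`card_subgroup_le_prod`). Repeating this while the quotient is not elementary abelian leaves the
case where all squares lie in ⟨z⟩ (`card_subgroup_prod_le`).

In that case s_{m+2} subgroups contain z, and those avoiding z are elementary abelian. If every
involution is central, they all lie in one maximal subgroup. Otherwise they are split by containment
in the centralizer of a noncentral involution. Both counts stay within the bound
(`card_subgroup_le_of_sq`), which D₈ × C₂^m reaches by inclusion-exclusion over two elementary
abelian maximal subgroups (`le_card_subgroup_dihedral_prod`). -/

theorem card_subgroup_congr {G H : Type*} [Group G] [Group H] (e : G ≃* H) :
    Nat.card (Subgroup G) = Nat.card (Subgroup H) :=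
  Nat.card_congr e.mapSubgroup.toEquiv

theorem mul_comm_of_sq_eq_one {E : Type*} [Group E] (h : ∀ x : E, x ^ 2 = 1) (x y : E) :
    x * y = y * x := by
  have h' : ∀ x : E, x⁻¹ = x := fun x => inv_eq_of_mul_eq_one_left (by rw [← sq, h])
  rw [← h' (x * y), mul_inv_rev, h', h']

/-- A group of exponent dividing `2` and of order `2 ^ m` is isomorphic to `C2Pow m`. -/
theorem nonempty_mulEquiv_c2Pow {E : Type*} [Group E] (h : ∀ x : E, x ^ 2 = 1) {m : ℕ}
    (hc : Nat.card E = 2 ^ m) : Nonempty (E ≃* C2Pow m) := by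
  let _ : CommGroup E := { (inferInstance : Group E) with mul_comm := mul_comm_of_sq_eq_one h }
  let _ : Module (ZMod 2) (Additive E) := AddCommGroup.zmodModule (n := 2) (fun x => h x.toMul)
  have : Finite E := Nat.finite_of_card_ne_zero (by rw [hc]; positivity)
  have : Finite (Additive E) := this
  have hr : Module.finrank (ZMod 2) (Additive E) = m := by
    have h1 := Module.natCard_eq_pow_finrank (K := ZMod 2) (V := Additive E)
    have h2 : Nat.card (Additive E) = 2 ^ m := hc
    rw [h2, Nat.card_zmod] at h1
    exact (Nat.pow_right_injective le_rfl h1).symm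
  let φ : Additive E ≃ₗ[ZMod 2] (Fin m → ZMod 2) :=
    LinearEquiv.ofFinrankEq _ _ (by simpa using hr)
  exact ⟨{  toFun := fun x i => Multiplicative.ofAdd (φ (Additive.ofMul x) i)
            invFun := fun v => (φ.symm fun i => (v i).toAdd).toMul
            left_inv := fun x => by simp
            right_inv := fun v => by ext i; simp
            map_mul' := fun x y => by ext i; simp }⟩

theorem card_subgroup_of_sq_eq_one {E : Type*} [Group E] (h : ∀ x : E, x ^ 2 = 1) {m : ℕ}
    (hc : Nat.card E = 2 ^ m) : Nat.card (Subgroup E) = Nat.card (Subgroup (C2Pow m)) :=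
  card_subgroup_congr (nonempty_mulEquiv_c2Pow h hc).some

/-! ### Subgroups containing or avoiding a central involution -/

/-- If the kernel of a surjection `f` is generated by `z`, the subgroups containing `z`
correspond to the subgroups of the target. -/
theorem ncard_subgroup_mem {G Q : Type*} [Group G] [Group Q] (f : G →* Q)
    (hf : Function.Surjective f) {z : G} (hk : f.ker = Subgroup.zpowers z) :
    {H : Subgroup G | z ∈ H}.ncard = Nat.card (Subgroup Q) := by
  rw [← Nat.card_coe_set_eq]
  refine Nat.card_congr ⟨fun H => H.1.map f, fun K => ⟨K.comap f, ?_⟩, fun H => ?_, fun K => ?_⟩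
  · have : z ∈ f.ker := hk ▸ Subgroup.mem_zpowers z
    simp [Subgroup.mem_comap, f.mem_ker.1 this, K.one_mem]
  · refine Subtype.ext (Subgroup.comap_map_eq_self ?_)
    rw [hk]; exact Subgroup.zpowers_le.2 H.2
  · exact Subgroup.map_comap_eq_self_of_surjective hf K

theorem ncard_subgroup_add {G : Type*} [Group G] [Finite G] (p : Subgroup G → Prop) :
    {H | p H}.ncard + {H | ¬ p H}.ncard = Nat.card (Subgroup G) := by
  have := Set.ncard_add_ncard_compl {H | p H}
  rwa [Set.compl_ofPred] at this

theorem ncard_subgroup_le_notMem {G : Type*} [Group G] (D : Subgroup G) {z : G} (hz : z ∈ D) :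
    {H : Subgroup G | H ≤ D ∧ z ∉ H}.ncard = {H : Subgroup D | (⟨z, hz⟩ : D) ∉ H}.ncard := by
  rw [← Nat.card_coe_set_eq, ← Nat.card_coe_set_eq]
  refine Nat.card_congr ⟨fun H => ⟨H.1.subgroupOf D, ?_⟩, fun K => ⟨K.1.map D.subtype, ?_⟩,
    fun H => ?_, fun K => ?_⟩
  · simpa [Subgroup.mem_subgroupOf] using H.2.2
  · refine ⟨Subgroup.map_subtype_le _, ?_⟩
    rintro ⟨x, hx, rfl⟩
    exact K.2 hx
  · exact Subtype.ext (Subgroup.map_subgroupOf_eq_of_le H.2.1)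
  · refine Subtype.ext (Subgroup.ext fun x => ?_)
    simp [Subgroup.mem_subgroupOf]

theorem mem_zpowers_of_sq_eq_one {G : Type*} [Group G] {z : G} (hz : z ^ 2 = 1) {g : G} :
    g ∈ Subgroup.zpowers z ↔ g = 1 ∨ g = z := by
  constructor
  · rintro ⟨k, rfl⟩
    have h2 : z ^ (2 : ℤ) = 1 := by exact_mod_cast hz
    rcases Int.even_or_odd' k with ⟨j, rfl | rfl⟩
    · left; simp [zpow_mul, h2]
    · right; simp [zpow_add, zpow_mul, h2]
  · rintro (rfl | rfl)
    · exact Subgroup.one_mem _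
    · exact Subgroup.mem_zpowers _

theorem zpowers_normal_of_central {G : Type*} [Group G] {z : G} (hz : ∀ g, z * g = g * z) :
    (Subgroup.zpowers z).Normal :=
  ⟨fun n hn g => by
    have hle : Subgroup.zpowers z ≤ Subgroup.center G :=
      Subgroup.zpowers_le.2 (Subgroup.mem_center_iff.2 fun g => (hz g).symm)
    rwa [Subgroup.mem_center_iff.1 (hle hn) g, mul_inv_cancel_right]⟩

theorem card_quotient_zpowers {G : Type*} [Group G] {z : G} (h1 : z ≠ 1) (h2 : z ^ 2 = 1) {m : ℕ}
    (hc : Nat.card G = 2 ^ (m + 1)) : Nat.card (G ⧸ Subgroup.zpowers z) = 2 ^ m := by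
  have := Subgroup.card_eq_card_quotient_mul_card_subgroup (Subgroup.zpowers z)
  rw [Nat.card_zpowers, orderOf_eq_prime h2 h1, hc, pow_succ] at this
  omega

/-- If all squares lie in `⟨z⟩` with `z` a central involution, the subgroups that contain `z`
are as many as the subgroups of `C2Pow m`. -/
theorem ncard_subgroup_mem_eq {G : Type*} [Group G] {z : G} (hz : ∀ g, z * g = g * z)
    (h1 : z ≠ 1) (h2 : z ^ 2 = 1) (hsq : ∀ g : G, g ^ 2 = 1 ∨ g ^ 2 = z) {m : ℕ}
    (hc : Nat.card G = 2 ^ (m + 1)) :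
    {H : Subgroup G | z ∈ H}.ncard = Nat.card (Subgroup (C2Pow m)) := by
  have := zpowers_normal_of_central hz
  rw [ncard_subgroup_mem (QuotientGroup.mk' _) (QuotientGroup.mk'_surjective _)
    (QuotientGroup.ker_mk' (Subgroup.zpowers z))]
  refine card_subgroup_of_sq_eq_one (fun x => ?_) (card_quotient_zpowers h1 h2 hc)
  induction x using QuotientGroup.induction_on with
  | H g =>
    rw [← QuotientGroup.mk_pow, QuotientGroup.eq_one_iff, mem_zpowers_of_sq_eq_one h2]
    exact hsq g

/-- The number of subgroups of an elementary abelian group avoiding a given involution. -/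
theorem ncard_subgroup_notMem_of_sq_eq_one {E : Type*} [Group E] (h : ∀ x : E, x ^ 2 = 1) {z : E}
    (h1 : z ≠ 1) {m : ℕ} (hc : Nat.card E = 2 ^ (m + 1)) :
    {H : Subgroup E | z ∉ H}.ncard + Nat.card (Subgroup (C2Pow m))
      = Nat.card (Subgroup (C2Pow (m + 1))) := by
  have : Finite E := Nat.finite_of_card_ne_zero (by rw [hc]; positivity)
  rw [← ncard_subgroup_mem_eq (fun g => mul_comm_of_sq_eq_one h z g) h1 (h z)
    (fun g => Or.inl (h g)) hc, ← card_subgroup_of_sq_eq_one h hc, add_comm]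
  exact ncard_subgroup_add fun H => z ∈ H

/-- The number of subgroups of an elementary abelian subgroup avoiding a given involution. -/
theorem ncard_subgroup_le_notMem_of_sq_eq_one {G : Type*} [Group G] (D : Subgroup G)
    (h : ∀ x ∈ D, x ^ 2 = 1) {z : G} (hz : z ∈ D) (h1 : z ≠ 1) {m : ℕ}
    (hc : Nat.card D = 2 ^ (m + 1)) :
    {H : Subgroup G | H ≤ D ∧ z ∉ H}.ncard + Nat.card (Subgroup (C2Pow m))
      = Nat.card (Subgroup (C2Pow (m + 1))) := by
  rw [ncard_subgroup_le_notMem D hz]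
  exact ncard_subgroup_notMem_of_sq_eq_one (fun x => Subtype.ext (h x x.2))
    (fun h' => h1 (congrArg Subtype.val h')) hc

/-! ### Comparison of G with G/⟨z⟩ × C₂ -/

/-- Two factors z cancel, so the sign "in B or not" is multiplicative. This makes it a character in
`exists_graph_subgroup`. -/
theorem mul_mem_iff_iff_of_mem_or_mul_mem {G : Type*} [Group G] {B : Subgroup G} {z : G}
    (hz : ∀ g, z * g = g * z) (h2 : z ^ 2 = 1) {x y : G} (hx : x ∈ B ∨ x * z ∈ B)
    (hy : y ∈ B ∨ y * z ∈ B) : x * y ∈ B ↔ (x ∈ B ↔ y ∈ B) := by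
  by_cases hxB : x ∈ B
  · simp [hxB, B.mul_mem_cancel_left hxB]
  · have hxz := hx.resolve_left hxB
    by_cases hyB : y ∈ B
    · simp [hxB, hyB, B.mul_mem_cancel_right hyB]
    · have := B.mul_mem hxz (hy.resolve_left hyB)
      rw [mul_assoc, ← mul_assoc z, hz y, mul_assoc y, ← sq, h2, mul_one] at this
      simp [hxB, hyB, this]

/-- The subgroup of `Q × C₂` recording the image of `H` in `Q` together with the character of `H`
that measures membership in `B`. -/
theorem exists_graph_subgroup {G Q : Type*} [Group G] [Group Q] (π : G →* Q) {z : G}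
    (hz : ∀ g, z * g = g * z) (h2 : z ^ 2 = 1) (H B : Subgroup G)
    (hHB : ∀ h ∈ H, h ∈ B ∨ h * z ∈ B) :
    ∃ Γ : Subgroup (Q × Multiplicative (ZMod 2)),
      ∀ p, p ∈ Γ ↔ ∃ h ∈ H, π h = p.1 ∧ (p.2 = 1 ↔ h ∈ B) := by
  have key : ∀ a b : Multiplicative (ZMod 2), a * b = 1 ↔ (a = 1 ↔ b = 1) := by decide
  exact ⟨{  carrier := {p | ∃ h ∈ H, π h = p.1 ∧ (p.2 = 1 ↔ h ∈ B)}
            one_mem' := ⟨1, H.one_mem, by simp [B.one_mem]⟩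
            mul_mem' := by
              rintro p q ⟨h, hh, hp, hp'⟩ ⟨k, hk, hq, hq'⟩
              refine ⟨h * k, H.mul_mem hh hk, by simp [hp, hq], ?_⟩
              rw [Prod.snd_mul, key, hp', hq',
                mul_mem_iff_iff_of_mem_or_mul_mem hz h2 (hHB h hh) (hHB k hk)]
            inv_mem' := by
              rintro p ⟨h, hh, hp, hp'⟩
              exact ⟨h⁻¹, H.inv_mem hh, by simp [hp], by simp [hp']⟩ }, fun p => Iff.rfl⟩

/-- A family of subgroups that meet the kernel of `π` trivially, and are determined by their
image under `π` up to multiplication of elements by a central involution `z` of that kernel,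
embeds in the set of subgroups of `Q × C₂` that avoid `1 × C₂`. -/
theorem exists_injOn_subgroup_prod {G Q : Type*} [Group G] [Group Q] (π : G →* Q) {z : G}
    (hz : ∀ g, z * g = g * z) (h1 : z ≠ 1) (h2 : z ^ 2 = 1) (hπ : π z = 1)
    (S : Set (Subgroup G)) (hS : ∀ H ∈ S, ∀ h ∈ H, π h = 1 → h = 1)
    (hS' : ∀ H ∈ S, ∀ H' ∈ S, H.map π = H'.map π → ∀ h ∈ H, h ∈ H' ∨ h * z ∈ H') :
    ∃ F : Subgroup G → Subgroup (Q × Multiplicative (ZMod 2)), Set.InjOn F S ∧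
      ∀ H ∈ S, ((1, Multiplicative.ofAdd 1) : Q × Multiplicative (ZMod 2)) ∉ F H ∧
        (F H).map (MonoidHom.fst _ _) = H.map π := by
  classical
  -- `B H` is a base member of `S` chosen from the image of `H` alone, so subgroups with equal image
  -- are measured against the same base.
  let B : Subgroup G → Subgroup G := fun H => Function.invFunOn (Subgroup.map π) S (H.map π)
  have hBS : ∀ H ∈ S, B H ∈ S := fun H hH => Function.invFunOn_mem ⟨H, hH, rfl⟩
  have hBm : ∀ H ∈ S, (B H).map π = H.map π := fun H hH => Function.invFunOn_eq ⟨H, hH, rfl⟩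
  have hzB : ∀ H ∈ S, z ∉ H := fun H hH hzH => h1 (hS H hH z hzH hπ)
  have hex : ∀ H ∈ S, ∃ Γ : Subgroup (Q × Multiplicative (ZMod 2)),
      ∀ p, p ∈ Γ ↔ ∃ h ∈ H, π h = p.1 ∧ (p.2 = 1 ↔ h ∈ B H) := fun H hH =>
    exists_graph_subgroup π hz h2 H (B H)
      (hS' H hH _ (hBS H hH) (hBm H hH).symm)
  choose! F hF using hex
  have hmap : ∀ H ∈ S, (F H).map (MonoidHom.fst _ _) = H.map π := by
    intro H hH
    ext q
    simp only [Subgroup.mem_map, MonoidHom.coe_fst]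
    constructor
    · rintro ⟨p, hp, rfl⟩
      obtain ⟨h, hh, hp, -⟩ := (hF H hH p).1 hp
      exact ⟨h, hh, hp⟩
    · rintro ⟨h, hh, rfl⟩
      refine ⟨(π h, if h ∈ B H then 1 else Multiplicative.ofAdd 1),
        (hF H hH _).2 ⟨h, hh, rfl, ?_⟩, rfl⟩
      by_cases hb : h ∈ B H <;> simp [hb]
  refine ⟨F, ?_, fun H hH => ⟨fun hmem => ?_, hmap H hH⟩⟩
  · have hle : ∀ H ∈ S, ∀ H' ∈ S, F H = F H' → H ≤ H' := by
      intro H hH H' hH' hFF h hh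
      have hm : H.map π = H'.map π := by rw [← hmap H hH, ← hmap H' hH', hFF]
      have hBB : B H = B H' := by simp only [B, hm]
      -- If h * z were in `H'`, equality of the graphs would give h and h * z the same sign. One of
      -- them lies in the base, hence both do, and so does z.
      refine (hS' H hH H' hH' hm h hh).resolve_right fun hhz => ?_
      have h3 : ((π h, if h ∈ B H then 1 else Multiplicative.ofAdd 1) :
          Q × Multiplicative (ZMod 2)) ∈ F H' := by
        rw [← hFF, hF H hH]
        refine ⟨h, hh, rfl, ?_⟩
        by_cases hb : h ∈ B H <;> simp [hb]
      obtain ⟨k, hk, hk1, hk2⟩ := (hF H' hH' _).1 h3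
      have hkz : k = h * z := by
        have := hS H' hH' _ (H'.mul_mem (H'.inv_mem hk) hhz) (by simp at hk1; simp [hk1, hπ])
        exact (inv_mul_eq_one.1 this)
      have hiff : h ∈ B H ↔ k ∈ B H := by
        rw [hBB, ← hk2, ← hBB]
        by_cases hb : h ∈ B H <;> simp [hb]
      have hd := hS' H hH _ (hBS H hH) (hBm H hH).symm h hh
      rw [← hkz] at hd
      have hhB : h ∈ B H := hd.elim id hiff.2
      have hkB := hiff.1 hhB
      rw [hkz, Subgroup.mul_mem_cancel_left _ hhB] at hkB
      exact hzB _ (hBS H hH) hkB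
    exact fun H hH H' hH' hFF => le_antisymm (hle H hH H' hH' hFF) (hle H' hH' H hH hFF.symm)
  · obtain ⟨h, hh, hp, hb⟩ := (hF H hH _).1 hmem
    obtain rfl := hS H hH h hh hp
    simp at hb

theorem ncard_subgroup_notMem_le {G Q : Type*} [Group G] [Group Q] [Finite Q] (f : G →* Q)
    {z : G} (hz : ∀ g, z * g = g * z) (h1 : z ≠ 1) (h2 : z ^ 2 = 1)
    (hk : f.ker = Subgroup.zpowers z) :
    {H : Subgroup G | z ∉ H}.ncard ≤ {Γ : Subgroup (Q × Multiplicative (ZMod 2)) |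
      ((1, Multiplicative.ofAdd 1) : Q × Multiplicative (ZMod 2)) ∉ Γ}.ncard := by
  have hker : ∀ g, f g = 1 ↔ g = 1 ∨ g = z := fun g => by
    rw [← f.mem_ker, hk, mem_zpowers_of_sq_eq_one h2]
  have hfz : f z = 1 := (hker z).2 (Or.inr rfl)
  obtain ⟨F, hF, hF'⟩ := exists_injOn_subgroup_prod f hz h1 h2 hfz {H | z ∉ H}
    (fun H hH h hh h' => ((hker h).1 h').resolve_right fun e => hH (e ▸ hh))
    (fun H _ H' _ hm h hh => by
      obtain ⟨k, hk', hkh⟩ : f h ∈ H'.map f := hm ▸ Subgroup.mem_map_of_mem f hh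
      have : f (h⁻¹ * k) = 1 := by simp [hkh]
      rcases (hker _).1 this with e | e
      · left; rwa [inv_mul_eq_one.1 e]
      · right; rwa [← inv_mul_eq_iff_eq_mul.1 e])
  exact Set.ncard_le_ncard_of_injOn F (fun H hH => (hF' H hH).1) hF (Set.toFinite _)

/-- Replacing `G` by `G / ⟨z⟩ × C₂`, where `z` is a central involution, does not decrease the
number of subgroups. -/
theorem card_subgroup_le_prod {G Q : Type*} [Group G] [Finite G] [Group Q] [Finite Q] (f : G →* Q)
    (hf : Function.Surjective f) {z : G} (hz : ∀ g, z * g = g * z) (h1 : z ≠ 1) (h2 : z ^ 2 = 1)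
    (hk : f.ker = Subgroup.zpowers z) :
    Nat.card (Subgroup G) ≤ Nat.card (Subgroup (Q × Multiplicative (ZMod 2))) := by
  let c : Q × Multiplicative (ZMod 2) := (1, Multiplicative.ofAdd 1)
  have hc2 : c ^ 2 = 1 := Prod.ext (one_pow 2)
    (show Multiplicative.ofAdd (1 : ZMod 2) ^ 2 = 1 by decide)
  have hkf : (MonoidHom.fst Q (Multiplicative (ZMod 2))).ker = Subgroup.zpowers c := by
    have hd : ∀ a : Multiplicative (ZMod 2), a = 1 ∨ a = Multiplicative.ofAdd 1 := by decide
    ext ⟨q, a⟩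
    rw [mem_zpowers_of_sq_eq_one hc2, MonoidHom.mem_ker]
    have := hd a
    simp only [MonoidHom.coe_fst, Prod.mk_eq_one, c, Prod.mk.injEq]
    tauto
  rw [← ncard_subgroup_add (fun H : Subgroup G => z ∈ H),
    ← ncard_subgroup_add (fun Γ : Subgroup (Q × Multiplicative (ZMod 2)) => c ∈ Γ),
    ncard_subgroup_mem f hf hk, ncard_subgroup_mem _ Prod.fst_surjective hkf]
  exact Nat.add_le_add_left (ncard_subgroup_notMem_le f hz h1 h2 hk) _

theorem card_subgroup_le_card_subgroup_c2Pow {G : Type*} [Group G] {z : G}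
    (hz : ∀ g, z * g = g * z) (h1 : z ≠ 1) (h2 : z ^ 2 = 1)
    (hsq : ∀ g : G, g ^ 2 = 1 ∨ g ^ 2 = z) {m : ℕ} (hc : Nat.card G = 2 ^ (m + 1)) :
    Nat.card (Subgroup G) ≤ Nat.card (Subgroup (C2Pow (m + 1))) := by
  have := zpowers_normal_of_central hz
  have : Finite G := Nat.finite_of_card_ne_zero (by rw [hc]; positivity)
  refine (card_subgroup_le_prod (QuotientGroup.mk' (Subgroup.zpowers z))
    (QuotientGroup.mk'_surjective _) hz h1 h2 (QuotientGroup.ker_mk' _)).trans_eq ?_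
  have h2' : ∀ a : Multiplicative (ZMod 2), a ^ 2 = 1 := by decide
  refine card_subgroup_of_sq_eq_one (fun x => Prod.ext ?_ (h2' _)) ?_
  · obtain ⟨q, a⟩ := x
    induction q using QuotientGroup.induction_on with
    | H g =>
      change ((g : G ⧸ Subgroup.zpowers z)) ^ 2 = 1
      rw [← QuotientGroup.mk_pow, QuotientGroup.eq_one_iff, mem_zpowers_of_sq_eq_one h2]
      exact hsq g
  · rw [Nat.card_prod, card_quotient_zpowers h1 h2 hc, pow_succ]
    congr 1
    exact Nat.card_zmod 2

/-- Inside D the subgroups containing z number exactly s_m, while D has at most s_{m+1} subgroups in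
all. -/
theorem ncard_subgroup_le_notMem_le {G : Type*} [Group G] (D : Subgroup G) {z : G}
    (hzD : z ∈ D) (hz : ∀ g, z * g = g * z) (h1 : z ≠ 1) (h2 : z ^ 2 = 1)
    (hsq : ∀ g : G, g ^ 2 = 1 ∨ g ^ 2 = z) {m : ℕ} (hc : Nat.card D = 2 ^ (m + 1)) :
    {H : Subgroup G | H ≤ D ∧ z ∉ H}.ncard + Nat.card (Subgroup (C2Pow m))
      ≤ Nat.card (Subgroup (C2Pow (m + 1))) := by
  have : Finite D := Nat.finite_of_card_ne_zero (by rw [hc]; positivity)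
  have hz' : ∀ g : D, ⟨z, hzD⟩ * g = g * ⟨z, hzD⟩ := fun g => Subtype.ext (hz g)
  have h1' : (⟨z, hzD⟩ : D) ≠ 1 := fun h => h1 (congrArg Subtype.val h)
  have h2' : (⟨z, hzD⟩ : D) ^ 2 = 1 := Subtype.ext h2
  have hsq' : ∀ g : D, g ^ 2 = 1 ∨ g ^ 2 = ⟨z, hzD⟩ := fun g => by
    simpa [Subtype.ext_iff] using hsq g
  rw [ncard_subgroup_le_notMem D hzD, ← ncard_subgroup_mem_eq hz' h1' h2' hsq' hc, add_comm,
    ncard_subgroup_add fun H : Subgroup D => (⟨z, hzD⟩ : D) ∈ H]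
  exact card_subgroup_le_card_subgroup_c2Pow hz' h1' h2' hsq' hc

/-! ### Hyperplane counts and the lower bound for D₈ × C₂^m -/

/-- The number of subgroups of an elementary abelian group that avoid an involution of a
hyperplane and are not contained in that hyperplane. -/
theorem ncard_subgroup_not_le_notMem {E : Type*} [Group E] (h : ∀ x : E, x ^ 2 = 1)
    (W : Subgroup E) {c : E} (hcW : c ∈ W) (h1 : c ≠ 1) {m : ℕ} (hE : Nat.card E = 2 ^ (m + 2))
    (hW : Nat.card W = 2 ^ (m + 1)) :
    {H : Subgroup E | ¬ H ≤ W ∧ c ∉ H}.ncard + 2 * Nat.card (Subgroup (C2Pow (m + 1)))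
      = Nat.card (Subgroup (C2Pow (m + 2))) + Nat.card (Subgroup (C2Pow m)) := by
  have : Finite E := Nat.finite_of_card_ne_zero (by rw [hE]; positivity)
  have hy : _ + _ = Nat.card (Subgroup (C2Pow (m + 2))) := ncard_subgroup_notMem_of_sq_eq_one h h1 hE
  have hw := ncard_subgroup_le_notMem_of_sq_eq_one W (fun x _ => h x) hcW h1 hW
  have hu : {H : Subgroup E | c ∉ H} = {H | H ≤ W ∧ c ∉ H} ∪ {H | ¬ H ≤ W ∧ c ∉ H} := by
    ext H
    simp only [Set.mem_ofPred_eq, Set.mem_union]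
    tauto
  have hd : Disjoint {H : Subgroup E | H ≤ W ∧ c ∉ H} {H | ¬ H ≤ W ∧ c ∉ H} :=
    Set.disjoint_left.2 fun H hH hH' => hH'.1 hH.1
  rw [hu, Set.ncard_union_eq hd] at hy
  omega

/-- A lower bound for the number of subgroups of a group with two elementary abelian
subgroups of index `2`. -/
theorem le_card_subgroup_of_two_subgroups {M : Type*} [Group M] {z : M} (hz : ∀ g, z * g = g * z)
    (h1 : z ≠ 1) (h2 : z ^ 2 = 1) (hsq : ∀ g : M, g ^ 2 = 1 ∨ g ^ 2 = z) {m : ℕ}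
    (hc : Nat.card M = 2 ^ (m + 3)) (C D : Subgroup M) (hzC : z ∈ C) (hzD : z ∈ D)
    (hC : ∀ x ∈ C, x ^ 2 = 1) (hD : ∀ x ∈ D, x ^ 2 = 1) (hcC : Nat.card C = 2 ^ (m + 2))
    (hcD : Nat.card D = 2 ^ (m + 2)) (hcI : Nat.card (C ⊓ D : Subgroup M) = 2 ^ (m + 1)) :
    3 * Nat.card (Subgroup (C2Pow (m + 2))) + Nat.card (Subgroup (C2Pow m))
        ≤ Nat.card (Subgroup M) + 3 * Nat.card (Subgroup (C2Pow (m + 1))) ∧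
      2 * Nat.card (Subgroup (C2Pow (m + 1)))
        ≤ Nat.card (Subgroup (C2Pow (m + 2))) + Nat.card (Subgroup (C2Pow m)) := by
  have : Finite M := Nat.finite_of_card_ne_zero (by rw [hc]; positivity)
  have ht := ncard_subgroup_add fun H : Subgroup M => z ∈ H
  rw [ncard_subgroup_mem_eq hz h1 h2 hsq hc] at ht
  have hA : _ + _ = Nat.card (Subgroup (C2Pow (m + 2))) :=
    ncard_subgroup_le_notMem_of_sq_eq_one C hC hzC h1 hcC
  have hB : _ + _ = Nat.card (Subgroup (C2Pow (m + 2))) :=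
    ncard_subgroup_le_notMem_of_sq_eq_one D hD hzD h1 hcD
  have hI := ncard_subgroup_le_notMem_of_sq_eq_one (C ⊓ D) (fun x hx => hC x hx.1) ⟨hzC, hzD⟩
    h1 hcI
  have hinter : {H : Subgroup M | H ≤ C ∧ z ∉ H} ∩ {H | H ≤ D ∧ z ∉ H}
      = {H | H ≤ C ⊓ D ∧ z ∉ H} := by
    ext H
    simp only [Set.mem_ofPred_eq, Set.mem_inter_iff, le_inf_iff]
    tauto
  have hunion := Set.ncard_union_add_ncard_inter
    {H : Subgroup M | H ≤ C ∧ z ∉ H} {H | H ≤ D ∧ z ∉ H}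
  have hle : ({H : Subgroup M | H ≤ C ∧ z ∉ H} ∪ {H | H ≤ D ∧ z ∉ H}).ncard
      ≤ {H : Subgroup M | z ∉ H}.ncard :=
    Set.ncard_le_ncard (Set.union_subset (fun H hH => hH.2) fun H hH => hH.2)
  -- This inclusion is the convexity inequality s_{m+1} - s_m ≤ s_{m+2} - s_{m+1}.
  have hIA : {H : Subgroup M | H ≤ C ⊓ D ∧ z ∉ H}.ncard
      ≤ {H : Subgroup M | H ≤ C ∧ z ∉ H}.ncard :=
    Set.ncard_le_ncard fun H hH => ⟨hH.1.trans inf_le_left, hH.2⟩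
  rw [hinter] at hunion
  constructor <;> omega

theorem natCard_subgroup_prod_top {G A : Type*} [Group G] [Group A] (V : Subgroup G) :
    Nat.card (V.prod (⊤ : Subgroup A)) = Nat.card V * Nat.card A := by
  rw [Nat.card_congr (V.prodEquiv ⊤).toEquiv, Nat.card_prod, Subgroup.card_top]

open DihedralGroup in
theorem le_card_subgroup_dihedral_prod (m : ℕ) :
    3 * Nat.card (Subgroup (C2Pow (m + 2))) + Nat.card (Subgroup (C2Pow m))
        ≤ Nat.card (Subgroup (DihedralGroup 4 × C2Pow m))
          + 3 * Nat.card (Subgroup (C2Pow (m + 1))) ∧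
      2 * Nat.card (Subgroup (C2Pow (m + 1)))
        ≤ Nat.card (Subgroup (C2Pow (m + 2))) + Nat.card (Subgroup (C2Pow m)) := by
  -- The centralizers of `sr 0` and `sr 1` are the two Klein four-subgroups of D₈; they meet in the
  -- centre {1, `r 2`}.
  let V : ZMod 4 → Subgroup (DihedralGroup 4) := fun i => Subgroup.centralizer {sr i}
  have hV : ∀ i x, x ∈ V i ↔ sr i * x = x * sr i := fun i x => by
    simp [V, Subgroup.mem_centralizer_singleton_iff, eq_comm]
  have hcard : ∀ i, Nat.card (V i) = 2 ^ 2 := fun i => by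
    have : (V i : Set (DihedralGroup 4)) = (Finset.univ.filter fun x => sr i * x = x * sr i) := by
      ext x; simp [hV]
    rw [← SetLike.coe_sort_coe, Nat.card_coe_set_eq, this, Set.ncard_coe_finset]
    clear this; clear_value V; revert i; decide
  have hcardI : Nat.card (V 0 ⊓ V 1 : Subgroup (DihedralGroup 4)) = 2 := by
    have : ((V 0 ⊓ V 1 : Subgroup _) : Set (DihedralGroup 4)) =
        (Finset.univ.filter fun x : DihedralGroup 4 => sr 0 * x = x * sr 0 ∧ sr 1 * x = x * sr 1) := by
      ext x; simp [hV]
    rw [← SetLike.coe_sort_coe, Nat.card_coe_set_eq, this, Set.ncard_coe_finset]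
    decide
  have hC2 : Nat.card (C2Pow m) = 2 ^ m := by
    rw [Nat.card_pi]; simp [Nat.card_eq_fintype_card, ZMod.card]
  have h2' : ∀ a : Multiplicative (ZMod 2), a ^ 2 = 1 := by decide
  have hA : ∀ a : C2Pow m, a ^ 2 = 1 := fun a => funext fun i => h2' (a i)
  have hsqV : ∀ i x, x ∈ V i → x ^ 2 = 1 := fun i x hx => by
    rw [hV] at hx; revert i x; decide
  have hz : ∀ g : DihedralGroup 4, r 2 * g = g * r 2 := by decide
  have hsq : ∀ g : DihedralGroup 4, g ^ 2 = 1 ∨ g ^ 2 = r 2 := by decide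
  have hr : (r 2 : DihedralGroup 4) ^ 2 = 1 := by decide
  have hr1 : (r 2 : DihedralGroup 4) ≠ 1 := by decide
  refine le_card_subgroup_of_two_subgroups (z := ((r 2, 1) : DihedralGroup 4 × C2Pow m))
    (fun g => Prod.ext (hz _) (by simp)) (fun h => hr1 (congrArg Prod.fst h))
    (Prod.ext hr (one_pow 2))
    (fun g => (hsq g.1).imp (fun h => Prod.ext h (hA _)) fun h => Prod.ext h (hA _))
    ?_ ((V 0).prod ⊤) ((V 1).prod ⊤) ?_ ?_ ?_ ?_ ?_ ?_ ?_
  · rw [Nat.card_prod, hC2, DihedralGroup.nat_card]; ring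
  · exact ⟨(hV _ _).2 (hz _).symm, trivial⟩
  · exact ⟨(hV _ _).2 (hz _).symm, trivial⟩
  · exact fun x hx => Prod.ext (hsqV _ _ hx.1) (hA _)
  · exact fun x hx => Prod.ext (hsqV _ _ hx.1) (hA _)
  · rw [natCard_subgroup_prod_top, hcard, hC2]; ring
  · rw [natCard_subgroup_prod_top, hcard, hC2]; ring
  · have : (V 0).prod ⊤ ⊓ (V 1).prod ⊤ = (V 0 ⊓ V 1).prod (⊤ : Subgroup (C2Pow m)) := by
      ext x; simp [Subgroup.mem_prod]
    rw [this, natCard_subgroup_prod_top, hcardI, hC2]; ring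

/-! ### Upper bound when all squares lie in ⟨z⟩ -/

/-- A subgroup H avoiding z is elementary abelian; if it does not centralize a, it contains neither
a nor az. So H meets ker π trivially, and its image in Q determines its elements up to the factor z
alone, since a factor a is excluded. The graph construction then lands in Q × C₂, one rank lower
than G/⟨z⟩ × C₂, among subgroups not inside the hyperplane that comes from the centralizer. -/
theorem ncard_subgroup_not_le_centralizer_le {G Q : Type*} [Group G] [Finite G] [Group Q]
    (π : G →* Q) (hπ : Function.Surjective π) (hQ : ∀ q : Q, q ^ 2 = 1) {m : ℕ}
    (hcQ : Nat.card Q = 2 ^ (m + 1)) {z a : G} (hz : ∀ g, z * g = g * z) (h1 : z ≠ 1)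
    (h2 : z ^ 2 = 1) (hsq : ∀ g : G, g ^ 2 = 1 ∨ g ^ 2 = z)
    (hcomm : ∀ x y : G, x * y = y * x ∨ x * y = y * x * z) (ha : a ^ 2 = 1)
    (hker : ∀ g, π g = 1 → g = 1 ∨ g = z ∨ g = a ∨ g = a * z) (hπz : π z = 1)
    (hidx : (Subgroup.centralizer {a}).index = 2) :
    {H : Subgroup G | ¬ H ≤ Subgroup.centralizer {a} ∧ z ∉ H}.ncard
        + 2 * Nat.card (Subgroup (C2Pow (m + 1)))
      ≤ Nat.card (Subgroup (C2Pow (m + 2))) + Nat.card (Subgroup (C2Pow m)) := by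
  have : Finite Q := Finite.of_surjective π hπ
  set C := Subgroup.centralizer {a} with hC
  have hCm : ∀ g, g ∈ C ↔ g * a = a * g := fun g => Subgroup.mem_centralizer_singleton_iff
  have hcH : ∀ H : Subgroup G, z ∉ H → ∀ x ∈ H, ∀ y ∈ H, x * y = y * x := by
    intro H hH x hx y hy
    refine (hcomm x y).resolve_right fun h => hH ?_
    rw [← inv_mul_eq_iff_eq_mul] at h
    exact h ▸ H.mul_mem (H.inv_mem (H.mul_mem hy hx)) (H.mul_mem hx hy)
  have hsH : ∀ H : Subgroup G, z ∉ H → ∀ x ∈ H, x ^ 2 = 1 := fun H hH x hx =>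
    (hsq x).resolve_right fun h => hH (h ▸ H.pow_mem hx 2)
  -- For h outside the centralizer, h * a has order 4, so it cannot lie in a subgroup avoiding z.
  have htw : ∀ h, h ∉ C → h ^ 2 = 1 → (h * a) ^ 2 = z := by
    intro h hh hh2
    have := (hcomm h a).resolve_left (fun e => hh ((hCm h).2 e))
    calc (h * a) ^ 2 = (h * a) * (a * h * z) := by rw [sq]; nth_rw 2 [this]
      _ = h * (a ^ 2) * h * z := by simp only [sq, mul_assoc]
      _ = h ^ 2 * z := by rw [ha, mul_one, sq]
      _ = z := by rw [hh2, one_mul]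
  have htw' : ∀ h, h ∉ C → h ^ 2 = 1 → (h * (a * z)) ^ 2 = z := by
    intro h hh hh2
    rw [← mul_assoc, Commute.mul_pow (hz _).symm, htw h hh hh2, h2, mul_one]
  have hkC : ∀ g, π g = 1 → g ∈ C := by
    intro g hg
    rw [hCm]
    rcases hker g hg with rfl | rfl | rfl | rfl
    · simp
    · exact hz a
    · rfl
    · rw [mul_assoc, hz]
  let S : Set (Subgroup G) := {H | ¬ H ≤ C ∧ z ∉ H}
  obtain ⟨F, hF, hF'⟩ := exists_injOn_subgroup_prod π hz h1 h2 hπz S (by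
    rintro H ⟨hHC, hzH⟩ h hh hπh
    obtain ⟨x, hx, hxC⟩ := SetLike.not_le_iff_exists.1 hHC
    rw [hCm] at hxC
    have hxh := hcH H hzH x hx h hh
    rcases hker h hπh with rfl | rfl | rfl | rfl
    · rfl
    · exact absurd hh hzH
    · exact absurd hxh hxC
    · rw [mul_assoc, hz, ← mul_assoc, ← mul_assoc] at hxh
      exact absurd (mul_right_cancel hxh) hxC) (by
    rintro H ⟨hHC, hzH⟩ H' ⟨-, hzH'⟩ hm
    have hex : ∀ h ∈ H, h ∈ H' ∨ h * z ∈ H' ∨ h * a ∈ H' ∨ h * (a * z) ∈ H' := by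
      intro h hh
      obtain ⟨k, hk, hkh⟩ : π h ∈ H'.map π := hm ▸ Subgroup.mem_map_of_mem π hh
      have := hker (h⁻¹ * k) (by simp [hkh])
      simp only [inv_mul_eq_iff_eq_mul, mul_one] at this
      rcases this with rfl | rfl | rfl | rfl <;> tauto
    have hout : ∀ h ∈ H, h ∉ C → h ∈ H' ∨ h * z ∈ H' := by
      intro h hh hhC
      have hh2 := hsH H hzH h hh
      rcases hex h hh with h' | h' | h' | h'
      · exact Or.inl h'
      · exact Or.inr h'
      · exact absurd ((htw h hhC hh2).symm.trans (hsH H' hzH' _ h')) h1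
      · exact absurd ((htw' h hhC hh2).symm.trans (hsH H' hzH' _ h')) h1
    obtain ⟨x, hx, hxC⟩ := SetLike.not_le_iff_exists.1 hHC
    have hxk : ∀ k ∈ H', k * x = x * k := by
      intro k hk
      rcases hout x hx hxC with h' | h'
      · exact hcH H' hzH' k hk x h'
      · have := hcH H' hzH' k hk _ h'
        rw [mul_assoc x, hz k, ← mul_assoc, ← mul_assoc] at this
        exact mul_right_cancel this
    rw [hCm] at hxC
    intro h hh
    have hxh := hcH H hzH h hh x hx
    -- The element x commutes with h and with all of `H'`, but not with a.
    have hno : h * a ∉ H' := fun h' => by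
      have := hxk _ h'
      rw [← mul_assoc x, ← hxh, mul_assoc, mul_assoc] at this
      exact hxC (mul_left_cancel this).symm
    rcases hex h hh with h' | h' | h' | h'
    · exact Or.inl h'
    · exact Or.inr h'
    · exact absurd h' hno
    · have := hxk _ h'
      rw [← mul_assoc h, mul_assoc _ z, hz x, ← mul_assoc, ← mul_assoc] at this
      have := mul_right_cancel this
      rw [← mul_assoc x, ← hxh, mul_assoc, mul_assoc] at this
      exact absurd (mul_left_cancel this).symm hxC)
  have hcW : Nat.card (C.map π) = 2 ^ m := by
    have h := (C.map π).card_mul_index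
    rw [Subgroup.index_map_eq C hπ fun g hg => hkC g (π.mem_ker.1 hg), hidx, hcQ, pow_succ] at h
    omega
  have h2' : ∀ b : Multiplicative (ZMod 2), b ^ 2 = 1 := by decide
  have hcard2 : Nat.card (Multiplicative (ZMod 2)) = 2 := Nat.card_zmod 2
  rw [← ncard_subgroup_not_le_notMem (E := Q × Multiplicative (ZMod 2))
    (c := (1, Multiplicative.ofAdd 1)) (fun x => Prod.ext (hQ _) (h2' _))
    ((C.map π).prod ⊤) ⟨Subgroup.one_mem _, trivial⟩
    (fun h => absurd (congrArg Prod.snd h)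
      (show Multiplicative.ofAdd (1 : ZMod 2) ≠ 1 by decide))
    (by rw [Nat.card_prod, hcQ, hcard2]; ring)
    (by rw [natCard_subgroup_prod_top, hcW, hcard2]; ring)]
  refine Nat.add_le_add_right (Set.ncard_le_ncard_of_injOn F (fun H (hH : H ∈ S) => ?_) hF
    (Set.toFinite _)) _
  -- Since ker π lies in C, an image of H inside π(C) would force H ≤ C.
  refine ⟨fun hle => hH.1 ?_, (hF' H hH).1⟩
  intro h hh
  have hmem : π h ∈ (F H).map (MonoidHom.fst _ _) :=
    (hF' H hH).2 ▸ Subgroup.mem_map_of_mem π hh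
  obtain ⟨p, hp, hph⟩ := hmem
  obtain ⟨k, hk, hkp⟩ := (hle hp).1
  have hk' := hkC (k⁻¹ * h) (by
    rw [map_mul, map_inv, hkp]
    exact inv_mul_eq_one.2 hph)
  simpa using C.mul_mem hk hk'

/-- Groups in which all squares lie in a central subgroup of order `2`. -/
theorem card_subgroup_le_of_sq {G : Type*} [Group G] {z : G} (hz : ∀ g, z * g = g * z)
    (h1 : z ≠ 1) (h2 : z ^ 2 = 1) (hsq : ∀ g : G, g ^ 2 = 1 ∨ g ^ 2 = z) {m : ℕ}
    (hc : Nat.card G = 2 ^ (m + 3)) (hne : ∃ x : G, x ^ 2 ≠ 1) :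
    Nat.card (Subgroup G) ≤ Nat.card (Subgroup (DihedralGroup 4 × C2Pow m)) := by
  have : Finite G := Nat.finite_of_card_ne_zero (by rw [hc]; positivity)
  obtain ⟨hD, hconv⟩ := le_card_subgroup_dihedral_prod m
  have htot := ncard_subgroup_add fun H : Subgroup G => z ∈ H
  rw [ncard_subgroup_mem_eq hz h1 h2 hsq hc] at htot
  have hle : ∀ C : Subgroup G, z ∈ C → Nat.card C = 2 ^ (m + 2) →
      {H : Subgroup G | H ≤ C ∧ z ∉ H}.ncard + Nat.card (Subgroup (C2Pow (m + 1)))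
        ≤ Nat.card (Subgroup (C2Pow (m + 2))) := fun C hzC hcC =>
    ncard_subgroup_le_notMem_le C hzC hz h1 h2 hsq hcC
  -- If all involutions are central, the solutions of a² = 1 form a proper subgroup Ω containing
  -- every H that avoids z. A maximal subgroup above Ω gives the total 2s_{m+2} - s_{m+1}, and
  -- convexity finishes.
  by_cases hcen : ∀ a : G, a ^ 2 = 1 → ∀ g, a * g = g * a
  · let Ω : Subgroup G :=
      { carrier := {a | a ^ 2 = 1}
        one_mem' := one_pow 2
        mul_mem' := fun {a b} ha hb => by
          change (a * b) ^ 2 = 1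
          rw [Commute.mul_pow (hcen a ha b), ha, hb, one_mul]
        inv_mem' := fun {a} ha => by
          change a⁻¹ ^ 2 = 1
          rw [inv_pow, ha, inv_one] }
    obtain ⟨j, hj, hcΩ⟩ := (Nat.dvd_prime_pow Nat.prime_two).1 (hc ▸ Ω.card_subgroup_dvd_card)
    have hj' : j ≠ m + 3 := by
      rintro rfl
      obtain ⟨x, hx⟩ := hne
      have : Ω = ⊤ := Subgroup.eq_top_of_card_eq Ω (hcΩ.trans hc.symm)
      exact hx (show x ∈ Ω from this ▸ Subgroup.mem_top x)
    have : Fact (Nat.Prime 2) := ⟨Nat.prime_two⟩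
    obtain ⟨C, hcC, hΩC⟩ := Sylow.exists_subgroup_card_pow_prime_le 2 (n := j) (m := m + 2)
      (hc ▸ pow_dvd_pow 2 (by omega)) Ω hcΩ (by omega)
    have h := hle C (hΩC h2) hcC
    have hsub : {H : Subgroup G | z ∉ H}.ncard ≤ {H : Subgroup G | H ≤ C ∧ z ∉ H}.ncard :=
      Set.ncard_le_ncard fun H hH => ⟨fun x hx => hΩC ((hsq x).resolve_right fun h =>
        hH (h ▸ H.pow_mem hx 2)), hH⟩
    omega
  · push Not at hcen
    obtain ⟨a, ha, x, hax⟩ := hcen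
    have hN := zpowers_normal_of_central hz
    have hV : ∀ v : G ⧸ Subgroup.zpowers z, v ^ 2 = 1 := fun v => by
      induction v using QuotientGroup.induction_on with
      | H g =>
        rw [← QuotientGroup.mk_pow, QuotientGroup.eq_one_iff, mem_zpowers_of_sq_eq_one h2]
        exact hsq g
    have hcV : Nat.card (G ⧸ Subgroup.zpowers z) = 2 ^ (m + 2) := card_quotient_zpowers h1 h2 hc
    have hcomm : ∀ x y : G, x * y = y * x ∨ x * y = y * x * z := by
      intro x y
      have h : ((y * x : G) : G ⧸ Subgroup.zpowers z) = (x * y : G) :=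
        mul_comm_of_sq_eq_one hV (y : G ⧸ Subgroup.zpowers z) x
      rw [QuotientGroup.eq, mem_zpowers_of_sq_eq_one h2] at h
      simpa only [inv_mul_eq_iff_eq_mul, mul_one] using h
    have hCm : ∀ g, g ∈ Subgroup.centralizer {a} ↔ g * a = a * g := fun g =>
      Subgroup.mem_centralizer_singleton_iff
    have hxa : x * a = a * x * z := (hcomm x a).resolve_left fun h => hax h.symm
    have hidx : (Subgroup.centralizer {a}).index = 2 := by
      refine Subgroup.index_eq_two_iff.2 ⟨x, fun b => ?_⟩
      rw [hCm, hCm]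
      have hbx : b * x * a = b * a * z * x := by
        rw [mul_assoc b, hxa, mul_assoc (b * a), hz x, mul_assoc a, mul_assoc b]
      rcases hcomm b a with hb | hb
      · refine Or.inr ⟨hb, fun h => h1 ?_⟩
        rw [hbx, hb, ← mul_assoc] at h
        exact mul_left_cancel ((mul_right_cancel h).trans (mul_one _).symm)
      · refine Or.inl ⟨?_, fun h => h1 ?_⟩
        · rw [hbx, hb, mul_assoc _ z z, ← sq, h2, mul_one, mul_assoc]
        · rw [h] at hb
          exact mul_left_cancel (hb.symm.trans (mul_one _).symm)
    have ha1 : (a : G ⧸ Subgroup.zpowers z) ≠ 1 := by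
      rw [Ne, QuotientGroup.eq_one_iff, mem_zpowers_of_sq_eq_one h2]
      rintro (rfl | rfl)
      · simp at hax
      · exact hax (hz x)
    have hN' := zpowers_normal_of_central (mul_comm_of_sq_eq_one hV (a : G ⧸ Subgroup.zpowers z))
    -- The quotient by ⟨z, a⟩ is taken in two steps, each by a central involution.
    have hthird := ncard_subgroup_not_le_centralizer_le
      ((QuotientGroup.mk' (Subgroup.zpowers (a : G ⧸ Subgroup.zpowers z))).comp
        (QuotientGroup.mk' (Subgroup.zpowers z)))
      ((QuotientGroup.mk'_surjective _).comp (QuotientGroup.mk'_surjective _))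
      (fun q => by
        induction q using QuotientGroup.induction_on with
        | H v => rw [← QuotientGroup.mk_pow, hV, QuotientGroup.mk_one])
      (card_quotient_zpowers ha1 (hV _) hcV) hz h1 h2 hsq hcomm ha
      (fun g hg => by
        have hg' : ((g : G ⧸ Subgroup.zpowers z) :
          (G ⧸ Subgroup.zpowers z) ⧸ Subgroup.zpowers (a : G ⧸ Subgroup.zpowers z)) = 1 := hg
        rw [QuotientGroup.eq_one_iff, mem_zpowers_of_sq_eq_one (hV _)] at hg'
        rcases hg' with h | h
        · rw [QuotientGroup.eq_one_iff, mem_zpowers_of_sq_eq_one h2] at h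
          tauto
        · rw [eq_comm, QuotientGroup.eq, mem_zpowers_of_sq_eq_one h2] at h
          simp only [inv_mul_eq_iff_eq_mul, mul_one] at h
          tauto)
      (by
        have : (z : G ⧸ Subgroup.zpowers z) = 1 :=
          (QuotientGroup.eq_one_iff z).2 (Subgroup.mem_zpowers z)
        simp [this]) hidx
    have hcC : Nat.card (Subgroup.centralizer {a}) = 2 ^ (m + 2) := by
      have h := (Subgroup.centralizer {a}).card_mul_index
      rw [hidx, hc, pow_succ] at h
      omega
    have hsecond := hle _ ((hCm z).2 (hz a)) hcC
    have hu : {H : Subgroup G | z ∉ H} = {H | H ≤ Subgroup.centralizer {a} ∧ z ∉ H} ∪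
        {H | ¬ H ≤ Subgroup.centralizer {a} ∧ z ∉ H} := by
      ext H
      simp only [Set.mem_ofPred_eq, Set.mem_union]
      tauto
    have hun := Set.ncard_union_le {H : Subgroup G | H ≤ Subgroup.centralizer {a} ∧ z ∉ H}
      {H | ¬ H ≤ Subgroup.centralizer {a} ∧ z ∉ H}
    rw [← hu] at hun
    omega

/-! ### Reduction to the case where all squares lie in ⟨z⟩ -/

theorem exists_central_involution {Q : Type*} [Group Q] {k : ℕ}
    (hc : Nat.card Q = 2 ^ (k + 1)) : ∃ z : Q, (∀ g, z * g = g * z) ∧ z ≠ 1 ∧ z ^ 2 = 1 := by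
  have : Finite Q := Nat.finite_of_card_ne_zero (by rw [hc]; positivity)
  have : Fact (Nat.Prime 2) := ⟨Nat.prime_two⟩
  have hQ : IsPGroup 2 Q := IsPGroup.of_card hc
  have : Nontrivial Q := Finite.one_lt_card_iff_nontrivial.1 (by
    rw [hc]; exact Nat.one_lt_two_pow k.succ_ne_zero)
  have := hQ.center_nontrivial
  obtain ⟨n, hn, hcn⟩ := (hQ.to_subgroup (Subgroup.center Q)).nontrivial_iff_card.1 this
  obtain ⟨z, hz⟩ := exists_prime_orderOf_dvd_card' (G := Subgroup.center Q) 2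
    (hcn ▸ dvd_pow_self 2 hn.ne')
  refine ⟨z, fun g => (Subgroup.mem_center_iff.1 z.2 g).symm, fun h => ?_, ?_⟩
  · rw [OneMemClass.coe_eq_one.1 h, orderOf_one] at hz
    omega
  · rw [← Subgroup.coe_pow, ← hz, pow_orderOf_eq_one, Subgroup.coe_one]

/-- The elementary abelian factor A collects the copies of C₂ split off so far, so the order of Q ×
A stays fixed while Q shrinks. -/
theorem card_subgroup_prod_le (k : ℕ) {Q : Type*} [Group Q] (hc : Nat.card Q = 2 ^ k)
    (hne : ∃ x : Q, x ^ 2 ≠ 1) {A : Type} [Group A] (hA : ∀ a : A, a ^ 2 = 1) {r m : ℕ}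
    (hcA : Nat.card A = 2 ^ r) (hm : k + r = m + 3) :
    Nat.card (Subgroup (Q × A)) ≤ Nat.card (Subgroup (DihedralGroup 4 × C2Pow m)) := by
  induction k generalizing Q A r with
  | zero =>
    obtain ⟨x, hx⟩ := hne
    have := (Nat.card_eq_one_iff_unique.1 hc).1
    exact absurd (Subsingleton.elim _ _) hx
  | succ k ih =>
    have : Finite Q := Nat.finite_of_card_ne_zero (by rw [hc]; positivity)
    have : Finite A := Nat.finite_of_card_ne_zero (by rw [hcA]; positivity)
    obtain ⟨z, hz, h1, h2⟩ := exists_central_involution hc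
    have hz' : ∀ g : Q × A, (z, 1) * g = g * (z, 1) := fun g => Prod.ext (hz _) (by simp)
    have h1' : ((z, 1) : Q × A) ≠ 1 := fun h => h1 (congrArg Prod.fst h)
    have h2' : ((z, 1) : Q × A) ^ 2 = 1 := Prod.ext h2 (one_pow 2)
    by_cases hsq : ∀ g : Q, g ^ 2 = 1 ∨ g ^ 2 = z
    · refine card_subgroup_le_of_sq hz' h1' h2'
        (fun g => (hsq g.1).imp (fun h => Prod.ext h (hA _)) fun h => Prod.ext h (hA _)) ?_ ?_
      · rw [Nat.card_prod, hc, hcA, ← pow_add, hm]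
      · obtain ⟨x, hx⟩ := hne
        exact ⟨(x, 1), fun h => hx (congrArg Prod.fst h)⟩
    -- A square outside {1, z} survives in Q/⟨z⟩, so the smaller group is still not of exponent 2.
    · push Not at hsq
      obtain ⟨g, hg⟩ := hsq
      have := zpowers_normal_of_central hz
      have hC2 : ∀ b : Multiplicative (ZMod 2), b ^ 2 = 1 := by decide
      have hcard2 : Nat.card (Multiplicative (ZMod 2)) = 2 := Nat.card_zmod 2
      let f : Q × A →* (Q ⧸ Subgroup.zpowers z) × A :=
        (QuotientGroup.mk' (Subgroup.zpowers z)).prodMap (MonoidHom.id A)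
      refine (card_subgroup_le_prod f
        ((QuotientGroup.mk'_surjective _).prodMap Function.surjective_id) hz' h1' h2' ?_).trans ?_
      · ext ⟨q, a⟩
        rw [mem_zpowers_of_sq_eq_one h2', MonoidHom.mem_ker]
        change ((q : Q ⧸ Subgroup.zpowers z), a) = 1 ↔ _
        rw [Prod.mk_eq_one, QuotientGroup.eq_one_iff, mem_zpowers_of_sq_eq_one h2,
          Prod.mk_eq_one, Prod.mk.injEq]
        tauto
      · rw [card_subgroup_congr MulEquiv.prodAssoc]
        refine ih (card_quotient_zpowers h1 h2 hc) ⟨(g : Q ⧸ Subgroup.zpowers z), fun h => ?_⟩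
          (fun b => Prod.ext (hA _) (hC2 _)) (r := r + 1)
          (by rw [Nat.card_prod, hcA, hcard2, pow_succ]) (by omega)
        rw [← QuotientGroup.mk_pow, QuotientGroup.eq_one_iff, mem_zpowers_of_sq_eq_one h2] at h
        exact h.elim hg.1 hg.2

theorem corollary2p9 {G : Type*} [Group G] (n : ℕ) (hn : 3 ≤ n)
    (hcard : Nat.card G = 2 ^ n) (hG : ¬ IsElementaryAbelianGroup 2 G) :
    Nat.card (Subgroup G) ≤ Nat.card (Subgroup (DihedralGroup 4 × C2Pow (n - 3))) := by
  have hne : ∃ x : G, x ^ 2 ≠ 1 := by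
    by_contra! h
    exact hG ⟨mul_comm_of_sq_eq_one h, h⟩
  rw [← card_subgroup_congr (MulEquiv.prodUnique (M := G) (N := Unit))]
  exact card_subgroup_prod_le n hcard hne (fun _ => rfl) (r := 0) (by simp) (by omega)
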